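/- Let $n\ge 0$. For $A\subset\mathbf R^n$ and $\varepsilon\ge 0$ let $T_{A,\varepsilon}=\bigcup_{x\in A}\bar B(x,\varepsilon)$ be the closed $\varepsilon$-tubular neighbourhood of $A$. Let $\mathrm{Vol}_i$ denote $i$-dimensional volume and $\alpha_i$ the volume of the unit ball of $\mathbf R^i$. A polytope $P\subset\mathbf R^n$ is the convex hull of finitely many points; $[P]$ is the affine subspace it generates, $\mathcal F_i(P)$ is the finite set of its $i$-dimensional faces ($P$ itself is a face), and a facet is a face of dimension $\dim [P]-1$. The normal vector to a facet $G$ is the unit vector in the direction of $[P]$ that is orthogonal to $G$ and points into the half-space of $[P]$ bounded by $G$ that does not contain $P$. For a face $F$ of $P$, the normal exterior cone $C(F,P)$ is the orthogonal product (sum) of the convex cone generated by the normal vectors to the facets of $P$ containing $F$ with $[P]^\perp$. For $F\in\mathcal F_i(P)$, the exterior angle of $P$ along $F$ is $$\gamma(F,P)=\frac1{\alpha_{n-i}}\,\mathrm{Vol}_{n-i}\bigl(C(F,P)\cap\bar B(0,1)\bigr).$$ For every compact convex set $K\subset\mathbf R^n$ there are unique real numbers $\Lambda_0(K),\dots,\Lambda_n(K)$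 such that $$\forall\,\varepsilon\ge 0,\qquad \mathrm{Vol}_n(T_{K,\varepsilon})=\sum_{i=0}^n\alpha_i\,\Lambda_{n-i}(K)\,\varepsilon^i .\tag{1}$$ These numbers are invariant under the isometries of $\mathbf R^n$. If $P$ is a polytope, then for $0\le i\le n$ $$\Lambda_i(P)=\sum_{F\in\mathcal F_i(P)}\mathrm{Vol}_i(F)\,\gamma(F,P).\tag{2}$$ -/

import Mathlib

open MeasureTheory Set
open scoped InnerProductSpace Pointwise

noncomputable section

namespace SteinerTube

/-- Euclidean space `ℝⁿ`. -/
abbrev E (n : ℕ) : Type := EuclideanSpace ℝ (Fin n)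

variable {n : ℕ}

/-- The tubular neighbourhood `T_{A,ε}`: the union of the closed balls of radius `ε`
centred at the points of `A`. -/
def tube (A : Set (E n)) (ε : ℝ) : Set (E n) := ⋃ x ∈ A, Metric.closedBall x ε

/-- The `k`-dimensional volume of a subset of `ℝⁿ`, as a real number. The measure `μHE[k]` is the
`k`-dimensional Hausdorff measure, normalized to agree with Lebesgue measure on `ℝᵏ`. -/
def vol (k : ℕ) (A : Set (E n)) : ℝ := (μHE[k] : Measure (E n)).real A

/-- `α_k`, the volume of the unit ball of `ℝᵏ`. -/
def ballVolume (k : ℕ) : ℝ := (volume : Measure (E k)).real (Metric.closedBall 0 1)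

/-- A convex polytope: the convex hull of finitely many points. -/
def IsPolytope (P : Set (E n)) : Prop := ∃ S : Set (E n), S.Finite ∧ P = convexHull ℝ S

/-- The dimension of the affine subspace `[A]` generated by a nonempty set `A`. -/
def dim (A : Set (E n)) : ℕ := Module.finrank ℝ (vectorSpan ℝ A)

/-- The set `𝓕_i(P)` of `i`-dimensional faces of `P`. A face is a nonempty set of the form
`{x ∈ P | ∀ y ∈ P, l y ≤ l x}` for some linear form `l`, the choice `l = 0` giving `P` itself. -/
def faces (i : ℕ) (P : Set (E n)) : Set (Set (E n)) :=
  {F | F.Nonempty ∧ IsExposed ℝ P F ∧ dim F = i}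

/-- Facets of `P`: the faces of codimension one in the affine subspace `[P]` generated by `P`. -/
def IsFacet (P G : Set (E n)) : Prop := ∃ i : ℕ, G ∈ faces i P ∧ i + 1 = dim P

/-- `u` is the normal vector to the facet `G` of `P` inside `[P]`: the unit vector of the direction
of `[P]` that is orthogonal to `G` and points into the half-space bounded by `G` which does not
contain `P`. -/
def IsFacetNormal (P G : Set (E n)) (u : E n) : Prop :=
  ‖u‖ = 1 ∧ u ∈ vectorSpan ℝ P ∧ u ∈ (vectorSpan ℝ G)ᗮ ∧ ∀ x ∈ G, ∀ y ∈ P, ⟪u, y - x⟫_ℝ ≤ 0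

/-- The normal exterior cone of `P` along `A`, relative to `[P]`: the convex cone generated by the
normal vectors to the facets of `P` containing `A` (it is `{0}` if there are none). For `A = {x}`
this is the cone at the point `x`; the cone along a face `F` is the cone at any point of `F` that
lies on no smaller face. -/
def relNormalCone (A P : Set (E n)) : PointedCone ℝ (E n) :=
  PointedCone.hull ℝ {u | ∃ G, IsFacet P G ∧ A ⊆ G ∧ IsFacetNormal P G u}

/-- The normal exterior cone `C(A, P)` in `ℝⁿ`: the orthogonal product of the cone relative to `[P]`
with `[P]^⊥`. -/
def normalCone (A P : Set (E n)) : Set (E n) :=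
  (relNormalCone A P : Set (E n)) + ((vectorSpan ℝ P)ᗮ : Set (E n))

/-- The exterior angle `γ(F, P)` of `P` along a face `F`. -/
def exteriorAngle (F P : Set (E n)) : ℝ :=
  vol (n - dim F) (normalCone F P ∩ Metric.closedBall 0 1) / ballVolume (n - dim F)

/-- The number of faces of a polytope is finite, so that sums over `faces i P` are finite. -/
theorem finite_faces {P : Set (E n)} (hP : IsPolytope P) (i : ℕ) : (faces i P).Finite := by
  obtain ⟨S, hS, rfl⟩ := hP
  refine Set.Finite.of_finite_image (f := fun F => F.extremePoints ℝ)
    (hS.finite_subsets.subset ?_) ?_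
  · rintro _ ⟨F, ⟨-, hF, -⟩, rfl⟩
    exact hF.isExtreme.extremePoints_subset_extremePoints.trans extremePoints_convexHull_subset
  · rintro F ⟨-, hF, -⟩ F' ⟨-, hF', -⟩ h
    have key : ∀ G : Set (E n), IsExposed ℝ (convexHull ℝ S) G →
        closure (convexHull ℝ (G.extremePoints ℝ)) = G := fun G hG =>
      closure_convexHull_extremePoints (hG.isCompact (Set.Finite.isCompact_convexHull ℝ hS))
        (hG.convex (convex_convexHull ℝ S))
    rw [← key F hF, ← key F' hF']
    exact congrArg (fun s => closure (convexHull ℝ s)) h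

end SteinerTube

end

open MeasureTheory Set
open scoped InnerProductSpace Pointwise

noncomputable section

namespace SteinerTube

variable {n : ℕ}

open Module Submodule Filter Topology

/-! Every point of the tube around a polytope `P` has a unique nearest point in `P`, which lies on
exactly one open face `F`; the displacement lies in the polar cone of `F`. The tube is thus a
disjoint union of orthogonal sums `openFace F P + (polarCone F P ∩ closedBall 0 ε)`. By Fubini each
has volume `Vol(F)` times `ε ^ (n - dim F)` times the volume of the truncated cone
(`tube_eq_biUnion`, `volume_piece`).

The exterior angle uses the cone generated by facet normals instead of the polar cone. A Farkas
argument (`polarCone_subset_closure`) shows that the former is dense in the latter. A convex set has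
null frontier, so both have the same volume and closedness of the generated cone is never needed.

A compact convex `K` is exhausted by polytopes whose tube volumes converge. A pointwise limit of
polynomials of degree at most `n` is again one, which gives the formula for `K`. The coefficients
are determined by the tube volumes, hence unique and invariant under isometries. -/

/-! ### Hausdorff measure and orthogonal sums -/

/-- On a set lying in a translate of a subspace `V`, the Hausdorff measure of dimension `dim V` is
the Lebesgue measure of `V`. -/
theorem hausdorff_eq_volume (V : Submodule ℝ (E n)) (x₀ : E n) {A : Set (E n)}
    (hA : ∀ x ∈ A, x - x₀ ∈ V) :
    (μHE[finrank ℝ V] : Measure (E n)) A = (volume : Measure V) {v | x₀ + v ∈ A} := by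
  have hiso : Isometry (fun v : V => x₀ + (v : E n)) :=
    (isometry_add_left x₀).comp isometry_subtype_coe
  have himg : A = (fun v : V => x₀ + (v : E n)) '' {v | x₀ + v ∈ A} := by
    ext x
    constructor
    · intro hx
      exact ⟨⟨x - x₀, hA x hx⟩, by simpa using hx, by simp⟩
    · rintro ⟨v, hv, rfl⟩
      exact hv
  conv_lhs => rw [himg]
  rw [hiso.euclideanHausdorffMeasure_image, InnerProductSpace.euclideanHausdorffMeasure_eq_volume]

theorem hausdorff_lt_top (V : Submodule ℝ (E n)) (x₀ : E n) {A : Set (E n)}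
    (hA : ∀ x ∈ A, x - x₀ ∈ V) (hb : Bornology.IsBounded A) :
    (μHE[finrank ℝ V] : Measure (E n)) A < ⊤ := by
  rw [hausdorff_eq_volume V x₀ hA]
  refine Bornology.IsBounded.measure_lt_top ?_
  obtain ⟨r, hr⟩ := hb.subset_closedBall x₀
  refine (Metric.isBounded_closedBall (x := (0 : V)) (r := r)).subset fun v hv => ?_
  have := hr hv
  simpa [dist_eq_norm] using this

/-- In the coordinates `V × Vᗮ` centred at `x₀` an orthogonal sum is a product set, so its measure
and measurability reduce to those of the factors. -/
theorem add_eq_preimage_prod (V : Submodule ℝ (E n)) (x₀ : E n) {A B : Set (E n)}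
    (hA : ∀ x ∈ A, x - x₀ ∈ V) (hB : B ⊆ Vᗮ) :
    A + B = V.measurableEquivProd x₀ ⁻¹'
      ({v : V | x₀ + v ∈ A} ×ˢ {w : Vᗮ | 0 + (w : E n) ∈ B}) := by
  rw [← MeasurableEquiv.image_symm]
  ext x
  rw [Set.mem_add]
  constructor
  · rintro ⟨a, ha, b, hb, rfl⟩
    refine ⟨⟨⟨a - x₀, hA a ha⟩, ⟨b, hB hb⟩⟩, ⟨?_, ?_⟩, ?_⟩
    · change x₀ + (a - x₀) ∈ A
      rwa [add_sub_cancel]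
    · change 0 + b ∈ B
      rwa [zero_add]
    · rw [measurableEquivProd_symm_apply, vadd_eq_add]
      dsimp only
      module
  · rintro ⟨⟨v, w⟩, ⟨hv, hw⟩, rfl⟩
    refine ⟨_, hv, _, hw, ?_⟩
    rw [measurableEquivProd_symm_apply, vadd_eq_add]
    dsimp only
    module

/-- The measure of an orthogonal sum of two sets is the product of their measures. -/
theorem volume_add_of_orthogonal (V : Submodule ℝ (E n)) (x₀ : E n) {A B : Set (E n)}
    (hA : ∀ x ∈ A, x - x₀ ∈ V) (hB : B ⊆ Vᗮ) :
    (volume : Measure (E n)) (A + B) =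
      (μHE[finrank ℝ V] : Measure (E n)) A * (μHE[finrank ℝ Vᗮ] : Measure (E n)) B := by
  rw [hausdorff_eq_volume V x₀ hA, hausdorff_eq_volume Vᗮ 0 (by simpa using fun x hx => hB hx),
    add_eq_preimage_prod V x₀ hA hB,
    ← InnerProductSpace.euclideanHausdorffMeasure_eq_volume (V := E n),
    (V.measurePreserving_measurableEquivProd x₀).measure_preimage_equiv, Measure.volume_eq_prod,
    Measure.prod_prod]

theorem measurableSet_add_of_orthogonal (V : Submodule ℝ (E n)) (x₀ : E n) {A B : Set (E n)}
    (hA : ∀ x ∈ A, x - x₀ ∈ V) (hB : B ⊆ Vᗮ) (hAm : MeasurableSet A) (hBm : MeasurableSet B) :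
    MeasurableSet (A + B) := by
  rw [add_eq_preimage_prod V x₀ hA hB]
  refine (V.measurableEquivProd x₀).measurable (MeasurableSet.prod ?_ ?_)
  · exact hAm.preimage (by fun_prop)
  · exact hBm.preimage (by fun_prop)

/-- A bounded set has measure zero in every dimension above that of its linear hull. -/
theorem hausdorff_eq_zero (V : Submodule ℝ (E n)) (x₀ : E n) {A : Set (E n)}
    (hA : ∀ x ∈ A, x - x₀ ∈ V) (hb : Bornology.IsBounded A) {i : ℕ} (hi : finrank ℝ V < i) :
    (μHE[i] : Measure (E n)) A = 0 :=
  -- Finite measure in one dimension forces measure zero in every higher one.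
  (Measure.euclideanHausdorffMeasure_zero_or_top hi A).resolve_right
    (hausdorff_lt_top V x₀ hA hb).ne

/-- The closure of a convex subset of a subspace adds nothing to its measure. -/
theorem hausdorff_diff_eq_zero (V : Submodule ℝ (E n)) {C D : Set (E n)} (hC : Convex ℝ C)
    (hD : D ⊆ V) (hDC : D ⊆ closure (C ∩ V)) :
    (μHE[finrank ℝ V] : Measure (E n)) (D \ C) = 0 := by
  rw [hausdorff_eq_volume V 0 (by simpa using fun x hx _ => hD hx)]
  have hconv : Convex ℝ {v : V | (v : E n) ∈ C} := hC.linear_preimage V.subtype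
  refine measure_mono_null ?_ (hconv.addHaar_frontier volume)
  rintro v ⟨hv, hvC⟩
  rw [zero_add] at hv hvC
  refine ⟨?_, fun h => hvC (interior_subset (s := {v : V | (v : E n) ∈ C}) h)⟩
  rw [closure_subtype]
  have himg : Subtype.val '' {v : V | (v : E n) ∈ C} = C ∩ V := by
    refine Set.ext fun x => ⟨?_, fun hx => ⟨⟨x, hx.2⟩, hx.1, rfl⟩⟩
    rintro ⟨w, hw, rfl⟩
    exact ⟨hw, w.2⟩
  rw [himg]
  exact hDC hv

/-! ### Faces, open faces and polar cones -/

/-- The vectors that, as linear forms, attain their maximum over `P` at every point of `F`. -/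
def polarCone (F P : Set (E n)) : Set (E n) := {v | ∀ x ∈ F, ∀ y ∈ P, ⟪v, y - x⟫_ℝ ≤ 0}

/-- All the faces of `P`. -/
def allFaces (P : Set (E n)) : Set (Set (E n)) := {F | F.Nonempty ∧ IsExposed ℝ P F}

/-- The points of `F` that lie on no face of `P` other than those containing `F`. -/
def openFace (F P : Set (E n)) : Set (E n) := {x ∈ F | ∀ G, IsExposed ℝ P G → x ∈ G → F ⊆ G}

theorem IsPolytope.isCompact {P : Set (E n)} (hP : IsPolytope P) : IsCompact P := by
  obtain ⟨S, hS, rfl⟩ := hP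
  exact Set.Finite.isCompact_convexHull ℝ hS

theorem IsPolytope.convex {P : Set (E n)} (hP : IsPolytope P) : Convex ℝ P := by
  obtain ⟨S, hS, rfl⟩ := hP
  exact convex_convexHull ℝ S

theorem dim_le (A : Set (E n)) : dim A ≤ n := by
  simpa [dim] using (vectorSpan ℝ A).finrank_le

theorem finite_allFaces {P : Set (E n)} (hP : IsPolytope P) : (allFaces P).Finite := by
  refine ((Finset.range (n + 1)).finite_toSet.biUnion
    fun i _ => finite_faces hP i).subset fun F hF => ?_
  exact mem_biUnion (by simpa [Nat.lt_succ_iff] using dim_le F) ⟨hF.1, hF.2, rfl⟩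

/-- Every point of a polytope lies in some open face. -/
theorem exists_mem_openFace {P : Set (E n)} (hP : IsPolytope P) {x : E n} (hx : x ∈ P) :
    ∃ F ∈ allFaces P, x ∈ openFace F P := by
  have hfin : {F | IsExposed ℝ P F ∧ x ∈ F}.Finite :=
    (finite_allFaces hP).subset fun F hF => ⟨⟨x, hF.2⟩, hF.1⟩
  have hmem : x ∈ ⋂₀ (hfin.toFinset : Set (Set (E n))) := fun G hG => by
    simp at hG
    exact hG.2
  -- The intersection of all faces through `x` is the smallest one.
  refine ⟨⋂₀ (hfin.toFinset : Set (Set (E n))), ⟨⟨x, hmem⟩, IsExposed.sInter ⟨P, ?_⟩ ?_⟩, hmem, ?_⟩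
  · simpa using ⟨IsExposed.refl P, hx⟩
  · intro G hG
    simp at hG
    exact hG.1
  · intro G hG hxG
    exact sInter_subset_of_mem (by simpa using ⟨hG, hxG⟩)

theorem eq_of_mem_openFace {P F G : Set (E n)} (hF : F ∈ allFaces P) (hG : G ∈ allFaces P)
    {x : E n} (hxF : x ∈ openFace F P) (hxG : x ∈ openFace G P) : F = G :=
  (hxF.2 G hG.2 hxG.1).antisymm (hxG.2 F hF.2 hxF.1)

/-- The set of maximum points of the linear form `⟪v, ·⟫` on `P`. -/
def support (P : Set (E n)) (v : E n) : Set (E n) := {x ∈ P | ∀ y ∈ P, ⟪v, y - x⟫_ℝ ≤ 0}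

theorem isExposed_support (P : Set (E n)) (v : E n) : IsExposed ℝ P (support P v) := by
  intro _
  refine ⟨innerSL ℝ v, ?_⟩
  ext x
  simp [support, inner_sub_right]

theorem exists_eq_support {P F : Set (E n)} (hF : F ∈ allFaces P) : ∃ v, F = support P v := by
  obtain ⟨l, hl⟩ := hF.2 hF.1
  refine ⟨(InnerProductSpace.toDual ℝ (E n)).symm l, ?_⟩
  rw [hl]
  ext x
  simp [support]

theorem support_inner_eq {P : Set (E n)} {v x y : E n} (hx : x ∈ support P v)
    (hy : y ∈ support P v) : ⟪v, y - x⟫_ℝ = 0 := by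
  refine (hx.2 y hy.1).antisymm ?_
  have := hy.2 x hx.1
  rw [← neg_sub, inner_neg_right] at this
  linarith

/-- A linear form that is constant on a set is orthogonal to its direction. -/
theorem mem_orthogonal_vectorSpan {A : Set (E n)} {v : E n}
    (h : ∀ x ∈ A, ∀ y ∈ A, ⟪v, y - x⟫_ℝ = 0) : v ∈ (vectorSpan ℝ A)ᗮ := by
  rw [Submodule.mem_orthogonal']
  intro w hw
  rw [vectorSpan_def] at hw
  induction hw using Submodule.span_induction with
  | mem w hw =>
    obtain ⟨y, hy, x, hx, rfl⟩ := Set.mem_vsub.1 hw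
    simpa using h x hx y hy
  | zero => simp
  | add a b _ _ ha hb => rw [inner_add_right, ha, hb, add_zero]
  | smul c a _ ha => rw [inner_smul_right, ha, mul_zero]

/-- The maximum set of `v` is a face through `x`, so it contains all of `F`. -/
theorem mem_polarCone_of_mem_openFace {P F : Set (E n)} (hF : F ∈ allFaces P) {x v : E n}
    (hx : x ∈ openFace F P) (hv : ∀ y ∈ P, ⟪v, y - x⟫_ℝ ≤ 0) : v ∈ polarCone F P := by
  intro z hz
  exact (hx.2 _ (isExposed_support P v) ⟨hF.2.subset hx.1, hv⟩ hz).2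

theorem polarCone_subset_orthogonal {P F : Set (E n)} (hF : F ∈ allFaces P) :
    polarCone F P ⊆ (vectorSpan ℝ F)ᗮ := by
  intro v hv
  refine mem_orthogonal_vectorSpan fun x hx y hy => ?_
  have h1 := hv x hx y (hF.2.subset hy)
  have h2 := hv y hy x (hF.2.subset hx)
  rw [← neg_sub, inner_neg_right] at h2
  linarith

theorem isClosed_polarCone (F P : Set (E n)) : IsClosed (polarCone F P) := by
  simp only [polarCone, ofPred_forall]
  refine isClosed_iInter fun x => isClosed_iInter fun _ => isClosed_iInter fun y =>
    isClosed_iInter fun _ => isClosed_le (by fun_prop) continuous_const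

/-! ### Decomposition of the tube by nearest points -/

/-- The projection to a compact convex set: it exists and is characterized by an obtuse angle. -/
theorem exists_projection {K : Set (E n)} (hK : IsCompact K) (hc : Convex ℝ K) (hne : K.Nonempty)
    (x : E n) : ∃ a ∈ K, (∀ y ∈ K, ‖x - a‖ ≤ ‖x - y‖) ∧ ∀ y ∈ K, ⟪x - a, y - a⟫_ℝ ≤ 0 := by
  obtain ⟨a, ha, h⟩ := exists_norm_eq_iInf_of_complete_convex hne hK.isComplete hc x
  refine ⟨a, ha, fun y hy => ?_, (norm_eq_iInf_iff_real_inner_le_zero hc ha).1 h⟩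
  rw [h]
  exact ciInf_le ⟨0, by rintro _ ⟨w, rfl⟩; exact norm_nonneg _⟩ (⟨y, hy⟩ : K)

/-- Adding the two obtuse-angle inequalities leaves `‖b - a‖ ^ 2 ≤ 0`. This makes the pieces of the
tube disjoint. -/
theorem projection_unique {K : Set (E n)} {a b v w : E n} (ha : a ∈ K) (hb : b ∈ K)
    (hv : ∀ y ∈ K, ⟪v, y - a⟫_ℝ ≤ 0) (hw : ∀ y ∈ K, ⟪w, y - b⟫_ℝ ≤ 0) (h : a + v = b + w) :
    a = b := by
  have h1 := hv b hb
  have h2 := hw a ha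
  have h3 : v = w + (b - a) := by rw [eq_sub_of_add_eq' h]; abel
  rw [h3, inner_add_left] at h1
  rw [← neg_sub, inner_neg_right] at h2
  have h4 : ⟪b - a, b - a⟫_ℝ ≤ 0 := by linarith
  rw [real_inner_self_eq_norm_sq] at h4
  have h5 : ‖b - a‖ = 0 := by nlinarith [norm_nonneg (b - a)]
  exact (sub_eq_zero.1 (norm_eq_zero.1 h5)).symm

/-- The tube around a polytope is cut into orthogonal products, one for each face. -/
theorem tube_eq_biUnion {P : Set (E n)} (hP : IsPolytope P) (ε : ℝ) :
    tube P ε = ⋃ F ∈ allFaces P, (openFace F P + (polarCone F P ∩ Metric.closedBall 0 ε)) := by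
  ext x
  simp only [tube, mem_iUnion, Set.mem_add, exists_prop]
  constructor
  · rintro ⟨y, hy, hxy⟩
    obtain ⟨a, ha, hmin, hobt⟩ := exists_projection hP.isCompact hP.convex ⟨y, hy⟩ x
    obtain ⟨F, hF, haF⟩ := exists_mem_openFace hP ha
    refine ⟨F, hF, a, haF, x - a, ⟨mem_polarCone_of_mem_openFace hF haF hobt, ?_⟩, by abel⟩
    rw [mem_closedBall_zero_iff]
    exact (hmin y hy).trans (by simpa [dist_eq_norm] using hxy)
  · rintro ⟨F, hF, a, ha, v, ⟨-, hv⟩, rfl⟩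
    exact ⟨a, hF.2.subset ha.1, by simpa using hv⟩

theorem pairwiseDisjoint_pieces (P : Set (E n)) (ε : ℝ) :
    (allFaces P).PairwiseDisjoint
      fun F => openFace F P + (polarCone F P ∩ Metric.closedBall 0 ε) := by
  intro F hF G hG hFG
  refine Set.disjoint_left.2 ?_
  rintro _ ⟨a, ha, v, hv, rfl⟩ ⟨b, hb, w, hw, h⟩
  have hab : a = b := projection_unique (hF.2.subset ha.1) (hG.2.subset hb.1)
    (hv.1 a ha.1) (hw.1 b hb.1) h.symm
  subst hab
  exact hFG (eq_of_mem_openFace hF hG ha hb)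

/-! ### Volumes of the pieces -/

theorem isCompact_of_mem_allFaces {P F : Set (E n)} (hP : IsPolytope P) (hF : F ∈ allFaces P) :
    IsCompact F := hF.2.isCompact hP.isCompact

theorem openFace_eq_diff {P F : Set (E n)} :
    openFace F P = F \ ⋃ G ∈ {G ∈ allFaces P | ¬ F ⊆ G}, G := by
  ext x
  simp only [openFace, allFaces, Set.mem_sdiff, mem_iUnion, not_exists]
  refine and_congr_right fun _ => ⟨fun h G hG hxG => hG.2 (h G hG.1.2 hxG), fun h G hG hxG => ?_⟩
  by_contra hFG
  exact h G ⟨⟨⟨x, hxG⟩, hG⟩, hFG⟩ hxG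

theorem measurableSet_openFace {P F : Set (E n)} (hP : IsPolytope P) (hF : F ∈ allFaces P) :
    MeasurableSet (openFace F P) := by
  rw [openFace_eq_diff]
  have hfin : {G ∈ allFaces P | ¬ F ⊆ G}.Finite := (finite_allFaces hP).subset fun G hG => hG.1
  exact (isCompact_of_mem_allFaces hP hF).measurableSet.diff
    (hfin.measurableSet_biUnion fun G hG => (isCompact_of_mem_allFaces hP hG.1).measurableSet)

/-- Cutting with a face that does not contain `F` lowers the dimension. -/
theorem finrank_inter_lt {P F G : Set (E n)} (hFP : F ⊆ P) (hG : G ∈ allFaces P)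
    (hFG : ¬ F ⊆ G) (hne : (F ∩ G).Nonempty) : dim (F ∩ G) < dim F := by
  obtain ⟨x, hxF, hxG⟩ := hne
  obtain ⟨v, rfl⟩ := exists_eq_support hG
  have hle : vectorSpan ℝ (F ∩ support P v) ≤ vectorSpan ℝ F := vectorSpan_mono ℝ inter_subset_left
  by_contra hlt
  have heq := Submodule.eq_of_le_of_finrank_le hle (not_lt.1 hlt)
  -- Equal dimensions would make `v` constant on all of `F`, which would put `F` inside `G`.
  have hv : v ∈ (vectorSpan ℝ (F ∩ support P v))ᗮ :=
    mem_orthogonal_vectorSpan fun a ha b hb => support_inner_eq ha.2 hb.2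
  rw [heq, Submodule.mem_orthogonal'] at hv
  refine hFG fun y hy => ⟨hFP hy, fun z hz => ?_⟩
  have h1 := hv _ (vsub_mem_vectorSpan ℝ hy hxF)
  have h2 := hxG.2 z hz
  rw [vsub_eq_sub] at h1
  rw [show z - y = (z - x) - (y - x) by abel, inner_sub_right, h1]
  linarith

/-- The points removed from `F` lie in finitely many sets `F ∩ G` of lower dimension. -/
theorem hausdorff_openFace {P F : Set (E n)} (hP : IsPolytope P) (hF : F ∈ allFaces P) :
    (μHE[dim F] : Measure (E n)) (openFace F P) = (μHE[dim F] : Measure (E n)) F := by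
  have hfin : {G ∈ allFaces P | ¬ F ⊆ G}.Finite := (finite_allFaces hP).subset fun G hG => hG.1
  refine measure_congr ?_
  rw [openFace_eq_diff, ← sdiff_inter_self_eq_sdiff]
  refine sdiff_null_ae_eq_self (measure_mono_null (t := ⋃ G ∈ {G ∈ allFaces P | ¬ F ⊆ G}, F ∩ G) ?_
    ((measure_biUnion_null_iff hfin.countable).2 fun G hG => ?_))
  · rintro x ⟨hx, hxF⟩
    simp only [mem_iUnion] at hx ⊢
    obtain ⟨G, hG, hxG⟩ := hx
    exact ⟨G, hG, hxF, hxG⟩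
  · rcases (F ∩ G).eq_empty_or_nonempty with h | ⟨x, hx⟩
    · rw [h, measure_empty]
    · exact hausdorff_eq_zero (vectorSpan ℝ (F ∩ G)) x (fun y hy => vsub_mem_vectorSpan ℝ hy hx)
        ((isCompact_of_mem_allFaces hP hF).isBounded.subset inter_subset_left)
        (finrank_inter_lt hF.2.subset hG.1 hG.2 ⟨x, hx⟩)

theorem smul_mem_polarCone {F P : Set (E n)} {v : E n} {c : ℝ} (hc : 0 ≤ c)
    (hv : v ∈ polarCone F P) : c • v ∈ polarCone F P := fun x hx y hy => by
  rw [real_inner_smul_left]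
  exact mul_nonpos_of_nonneg_of_nonpos hc (hv x hx y hy)

theorem polarCone_inter_closedBall {F P : Set (E n)} {ε : ℝ} (hε : 0 < ε) :
    polarCone F P ∩ Metric.closedBall 0 ε = ε • (polarCone F P ∩ Metric.closedBall 0 1) := by
  ext v
  rw [Set.mem_smul_set_iff_inv_smul_mem₀ hε.ne']
  simp only [mem_inter_iff, mem_closedBall_zero_iff, norm_smul, norm_inv, Real.norm_eq_abs,
    abs_of_pos hε, inv_mul_le_one₀ hε]
  refine and_congr_left fun _ => ⟨smul_mem_polarCone (inv_nonneg.2 hε.le), fun h => ?_⟩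
  simpa [smul_smul, hε.ne'] using smul_mem_polarCone hε.le h

theorem finrank_orthogonal_eq (F : Set (E n)) : finrank ℝ (vectorSpan ℝ F)ᗮ = n - dim F := by
  have := (vectorSpan ℝ F).finrank_add_finrank_orthogonal
  rw [finrank_euclideanSpace_fin] at this
  rw [dim]
  omega

theorem volume_piece {P F : Set (E n)} (hP : IsPolytope P) (hF : F ∈ allFaces P) {ε : ℝ}
    (hε : 0 < ε) :
    (volume : Measure (E n)).real (openFace F P + (polarCone F P ∩ Metric.closedBall 0 ε)) =
      vol (dim F) F * (ε ^ (n - dim F) *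
        vol (n - dim F) (polarCone F P ∩ Metric.closedBall 0 1)) := by
  obtain ⟨x₀, hx₀⟩ := hF.1
  have h := volume_add_of_orthogonal (vectorSpan ℝ F) x₀ (A := openFace F P)
    (B := polarCone F P ∩ Metric.closedBall 0 ε) (fun x hx => vsub_mem_vectorSpan ℝ hx.1 hx₀)
    (inter_subset_left.trans (polarCone_subset_orthogonal hF))
  rw [finrank_orthogonal_eq, ← dim, hausdorff_openFace hP hF, polarCone_inter_closedBall hε,
    Measure.euclideanHausdorffMeasure_smul₀ _ hε.ne'] at h
  rw [measureReal_def, polarCone_inter_closedBall hε, h, ENNReal.toReal_mul, vol, vol,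
    measureReal_def, measureReal_def]
  congr 1
  rw [ENNReal.smul_def, smul_eq_mul, ENNReal.toReal_mul]
  simp [abs_of_pos hε]

theorem measurableSet_piece {P F : Set (E n)} (hP : IsPolytope P) (hF : F ∈ allFaces P) (ε : ℝ) :
    MeasurableSet (openFace F P + (polarCone F P ∩ Metric.closedBall 0 ε)) := by
  obtain ⟨x₀, hx₀⟩ := hF.1
  exact measurableSet_add_of_orthogonal (vectorSpan ℝ F) x₀
    (fun x hx => vsub_mem_vectorSpan ℝ hx.1 hx₀)
    (inter_subset_left.trans (polarCone_subset_orthogonal hF))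
    (measurableSet_openFace hP hF)
    ((isClosed_polarCone F P).inter Metric.isClosed_closedBall).measurableSet

theorem tube_eq_cthickening {K : Set (E n)} (hK : IsCompact K) {ε : ℝ} (hε : 0 ≤ ε) :
    tube K ε = Metric.cthickening ε K := (hK.cthickening_eq_biUnion_closedBall hε).symm

theorem volume_tube_lt_top {K : Set (E n)} (hK : IsCompact K) {ε : ℝ} (hε : 0 ≤ ε) :
    (volume : Measure (E n)) (tube K ε) < ⊤ := by
  rw [tube_eq_cthickening hK hε]
  exact hK.cthickening.measure_lt_top

theorem volume_tube_polytope {P : Set (E n)} (hP : IsPolytope P) {ε : ℝ} (hε : 0 < ε) :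
    (volume : Measure (E n)).real (tube P ε) = ∑ F ∈ (finite_allFaces hP).toFinset,
      vol (dim F) F * (ε ^ (n - dim F) *
        vol (n - dim F) (polarCone F P ∩ Metric.closedBall 0 1)) := by
  have hfin := volume_tube_lt_top hP.isCompact hε.le
  have hcoe : tube P ε = ⋃ F ∈ (finite_allFaces hP).toFinset,
      (openFace F P + (polarCone F P ∩ Metric.closedBall 0 ε)) := by
    rw [tube_eq_biUnion hP]
    simp
  rw [hcoe] at hfin ⊢
  rw [measureReal_biUnion_finset (by simpa using pairwiseDisjoint_pieces P ε)
    (fun F hF => measurableSet_piece hP (by simpa using hF) ε)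
    (fun F hF => ((measure_mono (subset_biUnion_of_mem (u := fun F =>
      openFace F P + (polarCone F P ∩ Metric.closedBall 0 ε)) hF)).trans_lt hfin).ne)]
  exact Finset.sum_congr rfl fun F hF => volume_piece hP (by simpa using hF) hε

/-! ### Facets and their normals -/

/-- A convex set contained in none of finitely many affine subspaces has a point outside all of
them. -/
theorem exists_notMem_affineSubspaces {C : Set (E n)} (hC : Convex ℝ C) (hne : C.Nonempty)
    {T : Set (AffineSubspace ℝ (E n))} (hT : T.Finite) (h : ∀ A ∈ T, ¬ C ⊆ A) :
    ∃ p ∈ C, ∀ A ∈ T, p ∉ A := by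
  induction T, hT using Set.Finite.induction_on with
  | empty =>
    obtain ⟨p, hp⟩ := hne
    exact ⟨p, hp, by simp⟩
  | @insert A T hA hT ih =>
    obtain ⟨p, hp, hpT⟩ := ih fun B hB => h B (mem_insert_of_mem A hB)
    obtain ⟨c, hc, hcA⟩ := not_subset.1 (h A (mem_insert A T))
    -- Moving `p` slightly towards `c` keeps it off the members of `T`, which are closed, and takes
    -- it off `A`, which misses `c`.
    have hlim : Tendsto (fun t : ℝ => AffineMap.lineMap p c t) (𝓝[>] 0) (𝓝 p) := by
      refine Tendsto.mono_left ?_ nhdsWithin_le_nhds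
      exact Continuous.tendsto' (AffineMap.lineMap_continuous) _ _ (by simp)
    have hev : ∀ᶠ t : ℝ in 𝓝[>] 0, ∀ B ∈ T, AffineMap.lineMap p c t ∉ B := by
      refine (eventually_all_finite hT).2 fun B hB => ?_
      exact hlim.eventually ((B.closed_of_finiteDimensional.isOpen_compl).mem_nhds (hpT B hB))
    by_cases hpA : p ∈ A
    · obtain ⟨t, ht, ht0, ht1⟩ := (hev.and (Ioo_mem_nhdsGT (zero_lt_one (α := ℝ)))).exists
      refine ⟨AffineMap.lineMap p c t, hC.lineMap_mem hp hc ⟨ht0.le, ht1.le⟩, ?_⟩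
      rintro B (rfl | hB)
      · intro hmem
        refine hcA ?_
        have := AffineMap.lineMap_mem t⁻¹ hpA hmem
        simpa [AffineMap.lineMap_apply, smul_smul, ht0.ne'] using this
      · exact ht B hB
    · refine ⟨p, hp, ?_⟩
      rintro B (rfl | hB)
      exacts [hpA, hpT B hB]

theorem dim_le_of_subset_affineSpan {A B : Set (E n)} (h : A ⊆ affineSpan ℝ B) :
    dim A ≤ dim B := by
  refine Submodule.finrank_mono ?_
  rw [← direction_affineSpan, ← direction_affineSpan]
  exact AffineSubspace.direction_le (affineSpan_le.2 h)

theorem openFace_nonempty {P F : Set (E n)} (hP : IsPolytope P) (hF : F ∈ allFaces P) :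
    (openFace F P).Nonempty := by
  have hfin : {G ∈ allFaces P | ¬ F ⊆ G}.Finite := (finite_allFaces hP).subset fun G hG => hG.1
  obtain ⟨x, hx, hxT⟩ := exists_notMem_affineSubspaces (hF.2.convex hP.convex) hF.1
    (hfin.image fun G => affineSpan ℝ (F ∩ G)) (by
      rintro _ ⟨G, hG, rfl⟩ hsub
      rcases (F ∩ G).eq_empty_or_nonempty with h | h
      · obtain ⟨x, hx⟩ := hF.1
        simpa [h] using hsub hx
      · exact (dim_le_of_subset_affineSpan hsub).not_gt (finrank_inter_lt hF.2.subset hG.1 hG.2 h))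
  refine ⟨x, hx, fun G hG hxG => ?_⟩
  by_contra hFG
  exact hxT _ (mem_image_of_mem _ ⟨⟨⟨x, hxG⟩, hG⟩, hFG⟩) (subset_affineSpan ℝ _ ⟨hx, hxG⟩)

/-- Supporting hyperplanes: a point of `K` that is a limit of points of `[K]` outside `K` has a
normal vector in the direction of `[K]`. -/
theorem exists_normal_of_mem_closure {K : Set (E n)} (hK : IsCompact K) (hc : Convex ℝ K)
    {q : E n} (hq : q ∈ K) (hcl : q ∈ closure ((affineSpan ℝ K : Set (E n)) \ K)) :
    ∃ v ∈ vectorSpan ℝ K, ‖v‖ = 1 ∧ q ∈ support K v := by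
  -- Points of `[K]` outside `K` approach `q`; their normalized displacements from `K` subconverge
  -- to the normal.
  obtain ⟨u, hu, hlim⟩ := mem_closure_iff_seq_limit.1 hcl
  choose a ha hmin hobt using fun k => exists_projection hK hc ⟨q, hq⟩ (u k)
  have hne : ∀ k, u k - a k ≠ 0 := fun k h => (hu k).2 (sub_eq_zero.1 h ▸ ha k)
  have hdiff : Tendsto (fun k => u k - a k) atTop (𝓝 0) := by
    refine squeeze_zero_norm (fun k => hmin k q hq) ?_
    simpa using (hlim.sub_const q).norm
  have halim : Tendsto a atTop (𝓝 q) := by simpa using hlim.sub hdiff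
  let v : ℕ → E n := fun k => ‖u k - a k‖⁻¹ • (u k - a k)
  have hvnorm : ∀ k, ‖v k‖ = 1 := fun k => by
    simp only [v, norm_smul, norm_inv, norm_norm]
    exact inv_mul_cancel₀ (norm_ne_zero_iff.2 (hne k))
  obtain ⟨w, hw, φ, hφ, hvw⟩ := (isCompact_sphere (0 : E n) 1).tendsto_subseq
    (x := v) fun k => by simpa using hvnorm k
  refine ⟨w, ?_, by simpa using hw, hq, fun y hy => ?_⟩
  · refine (vectorSpan ℝ K).closed_of_finiteDimensional.mem_of_tendsto hvw
      (Eventually.of_forall fun k => Submodule.smul_mem _ _ ?_)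
    rw [← direction_affineSpan]
    exact AffineSubspace.vsub_mem_direction (hu _).1 (subset_affineSpan ℝ K (ha _))
  · refine le_of_tendsto (hvw.inner (tendsto_const_nhds.sub (halim.comp hφ.tendsto_atTop)))
      (Eventually.of_forall fun k => ?_)
    simp only [Function.comp_apply, v, real_inner_smul_left]
    exact mul_nonpos_of_nonneg_of_nonpos (by positivity) (hobt _ y hy)

/-- With equal dimensions `v` would be orthogonal to `[P]`, hence to itself. -/
theorem dim_support_lt {P : Set (E n)} {v : E n} (hv : v ∈ vectorSpan ℝ P) (h0 : ‖v‖ = 1) :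
    dim (support P v) < dim P := by
  have hle : vectorSpan ℝ (support P v) ≤ vectorSpan ℝ P := vectorSpan_mono ℝ fun x hx => hx.1
  by_contra hlt
  have heq := Submodule.eq_of_le_of_finrank_le hle (not_lt.1 hlt)
  have hv' : v ∈ (vectorSpan ℝ (support P v))ᗮ :=
    mem_orthogonal_vectorSpan fun a ha b hb => support_inner_eq ha hb
  rw [heq, Submodule.mem_orthogonal'] at hv'
  have := hv' v hv
  rw [real_inner_self_eq_norm_sq, h0] at this
  norm_num at this

/-- A polytope is cut out of its affine hull by its facets. -/
theorem exists_facet_separating {P : Set (E n)} (hP : IsPolytope P) {y : E n}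
    (hy : y ∈ affineSpan ℝ P) (hyP : y ∉ P) :
    ∃ G u, IsFacet P G ∧ IsFacetNormal P G u ∧ ∃ q ∈ G, 0 < ⟪u, y - q⟫_ℝ := by
  have hne : P.Nonempty := (affineSpan_nonempty ℝ).1 ⟨y, hy⟩
  have hfin := finite_allFaces hP
  -- Generic `p`: the segment to `y` then leaves `P` through no face of codimension two or more, and
  -- `p` lies on no proper face.
  obtain ⟨p, hp, hpT⟩ := exists_notMem_affineSubspaces hP.convex hne
    (((hfin.subset (sep_subset _ fun G => dim G + 1 < dim P)).image
      fun G => affineSpan ℝ (insert y G)).union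
      ((hfin.subset (sep_subset _ fun G => dim G < dim P)).image fun G => affineSpan ℝ G)) (by
    rintro _ (⟨G, hG, rfl⟩ | ⟨G, hG, rfl⟩) hsub
    · have h1 := dim_le_of_subset_affineSpan hsub
      have h2 : dim (insert y G) ≤ dim G + 1 := finrank_vectorSpan_insert_le_set ℝ G y
      have h3 : dim G + 1 < dim P := hG.2
      omega
    · exact (dim_le_of_subset_affineSpan hsub).not_gt hG.2)
  let f : ℝ → E n := fun t => AffineMap.lineMap p y t
  have hf : Continuous f := AffineMap.lineMap_continuous
  obtain ⟨s, ⟨hs, hsP⟩, hmax⟩ := (isCompact_Icc.inter_right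
    (hP.isCompact.isClosed.preimage hf)).exists_isGreatest (s := Icc 0 1 ∩ f ⁻¹' P)
    ⟨0, by simp, by simpa [f] using hp⟩
  have hs1 : s < 1 := lt_of_le_of_ne hs.2 fun h => hyP (by simpa [f, h] using hsP)
  have hcl : f s ∈ closure ((affineSpan ℝ P : Set (E n)) \ P) := by
    refine mem_closure_of_tendsto (hf.continuousWithinAt (s := Ioi s)) ?_
    filter_upwards [Ioo_mem_nhdsGT hs1] with t ht
    refine ⟨AffineMap.lineMap_mem t (subset_affineSpan ℝ P hp) hy, fun htP => ?_⟩
    exact (hmax ⟨⟨hs.1.trans ht.1.le, ht.2.le⟩, htP⟩).not_gt ht.1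
  obtain ⟨v, hv, hv1, hq⟩ := exists_normal_of_mem_closure hP.isCompact hP.convex hsP hcl
  have hlt := dim_support_lt hv hv1
  have hG : support P v ∈ allFaces P := ⟨⟨_, hq⟩, isExposed_support P v⟩
  have hpG : p ∉ support P v := fun h =>
    hpT _ (Or.inr ⟨_, ⟨hG, hlt⟩, rfl⟩) (subset_affineSpan ℝ _ h)
  have hfacet : dim (support P v) + 1 = dim P := by
    by_contra hne
    refine hpT _ (Or.inl ⟨_, ⟨hG, by omega⟩, rfl⟩) ?_
    have h1 : f s ∈ affineSpan ℝ (insert y (support P v)) :=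
      subset_affineSpan ℝ _ (mem_insert_of_mem _ hq)
    have h2 : y ∈ affineSpan ℝ (insert y (support P v)) :=
      subset_affineSpan ℝ _ (mem_insert _ _)
    -- The parameter `(1 - s)⁻¹` extends the line from `y` through `f s` back to `p`.
    have h3 := AffineMap.lineMap_mem (1 - s)⁻¹ h2 h1
    have h4 : (AffineMap.lineMap y (f s) (1 - s)⁻¹ : E n) = p := by
      have : (1 - s) ≠ 0 := by linarith
      simp only [f, AffineMap.lineMap_apply_module']
      rw [show s • (y - p) + p - y = (1 - s) • (p - y) by module, smul_smul,
        inv_mul_cancel₀ this]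
      module
    rwa [h4] at h3
  refine ⟨support P v, v, ⟨_, ⟨hG.1, hG.2, rfl⟩, hfacet⟩, ⟨hv1, hv,
    mem_orthogonal_vectorSpan fun a ha b hb => support_inner_eq ha hb, fun x hx => hx.2⟩,
    f s, hq, ?_⟩
  have h1 : ⟪v, p - f s⟫_ℝ < 0 := by
    refine lt_of_le_of_ne (hq.2 p hp) fun h => hpG ⟨hp, fun z hz => ?_⟩
    have := hq.2 z hz
    rw [show z - p = (z - f s) - (p - f s) by abel, inner_sub_right, h]
    linarith
  -- `p` and `y` lie on opposite sides of the exit point, so a negative value of `v` at `p` gives a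
  -- positive one at `y`.
  have h2 : p - f s = (-s) • (y - p) := by
    simp only [f, AffineMap.lineMap_apply_module']
    module
  have h3 : y - f s = (1 - s) • (y - p) := by
    simp only [f, AffineMap.lineMap_apply_module']
    module
  rw [h2, inner_smul_right] at h1
  rw [h3, inner_smul_right]
  have hs0 : 0 ≤ s := hs.1
  have : 0 < ⟪v, y - p⟫_ℝ := by
    by_contra hneg
    nlinarith
  exact mul_pos (by linarith) this

theorem IsFacet.mem_allFaces {P G : Set (E n)} (hG : IsFacet P G) : G ∈ allFaces P := by
  obtain ⟨i, hi, -⟩ := hG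
  exact ⟨hi.1, hi.2.1⟩

theorem IsFacet.dim_add_one {P G : Set (E n)} (hG : IsFacet P G) : dim G + 1 = dim P := by
  obtain ⟨i, hi, h⟩ := hG
  rw [hi.2.2, h]

/-- The maximum set of `u` contains `G` and is a proper face; if it were larger than `G`, its
dimension would exceed that of a facet. -/
theorem IsFacetNormal.support_eq {P G : Set (E n)} {u : E n} (hG : IsFacet P G)
    (hu : IsFacetNormal P G u) : support P u = G := by
  have hsub : G ⊆ support P u := fun x hx => ⟨hG.mem_allFaces.2.subset hx, hu.2.2.2 x hx⟩
  refine Subset.antisymm ?_ hsub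
  by_contra hnot
  have h1 := finrank_inter_lt (F := support P u) (fun x hx => hx.1) hG.mem_allFaces hnot
    (by rw [inter_eq_right.2 hsub]; exact hG.mem_allFaces.1)
  rw [inter_eq_right.2 hsub] at h1
  have h2 := dim_support_lt hu.2.1 hu.1
  have h3 := hG.dim_add_one
  omega

/-- The directions of `[P]` orthogonal to `G` form a line, so `w = ± u`; the opposite sign would
force `P ⊆ G`. -/
theorem IsFacetNormal.unique {P G : Set (E n)} {u w : E n} (hG : IsFacet P G)
    (hu : IsFacetNormal P G u) (hw : IsFacetNormal P G w) : w = u := by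
  have hle : vectorSpan ℝ G ≤ vectorSpan ℝ P := vectorSpan_mono ℝ hG.mem_allFaces.2.subset
  have hrank : finrank ℝ ((vectorSpan ℝ G)ᗮ ⊓ vectorSpan ℝ P : Submodule ℝ (E n)) = 1 := by
    have h1 := Submodule.finrank_add_inf_finrank_orthogonal hle
    have h2 := hG.dim_add_one
    simp only [dim] at h2
    omega
  have hu0 : u ≠ 0 := fun h => by simpa [h] using hu.1
  obtain ⟨c, hc⟩ := (finrank_eq_one_iff_of_nonzero'
    (⟨u, hu.2.2.1, hu.2.1⟩ : ((vectorSpan ℝ G)ᗮ ⊓ vectorSpan ℝ P : Submodule ℝ (E n)))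
    (fun h => hu0 (congrArg Subtype.val h))).1 hrank ⟨w, hw.2.2.1, hw.2.1⟩
  have hc' : c • u = w := congrArg Subtype.val hc
  have habs : |c| = 1 := by
    have := hw.1
    rwa [← hc', norm_smul, hu.1, mul_one, Real.norm_eq_abs] at this
  rcases eq_or_eq_neg_of_abs_eq habs with h | h
  · rw [← hc', h, one_smul]
  · exfalso
    have hwu : w = -u := by rw [← hc', h, neg_smul, one_smul]
    have hsup := hu.support_eq hG
    have hlt : dim G < dim P := by have := hG.dim_add_one; omega
    have : P ⊆ G := fun y hy => by
      obtain ⟨x, hx⟩ := hG.mem_allFaces.1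
      have h2 := hw.2.2.2 x hx y hy
      rw [hwu, inner_neg_left] at h2
      rw [← hsup]
      refine ⟨hy, fun z hz => ?_⟩
      have h3 := hu.2.2.2 x hx z hz
      rw [show z - y = (z - x) - (y - x) by abel, inner_sub_right]
      linarith
    exact (dim_le_of_subset_affineSpan (this.trans (subset_affineSpan ℝ G))).not_gt hlt

/-! ### Polar cone versus cone of facet normals -/

/-- A direction on the inner side of all facets through `x` points into the polytope. -/
theorem exists_add_smul_mem {P : Set (E n)} (hP : IsPolytope P) {x z : E n} (hx : x ∈ P)
    (hz : z ∈ vectorSpan ℝ P)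
    (h : ∀ G u, IsFacet P G → IsFacetNormal P G u → x ∈ G → ⟪u, z⟫_ℝ ≤ 0) :
    ∃ t : ℝ, 0 < t ∧ x + t • z ∈ P := by
  have hfin : {G | IsFacet P G}.Finite := (finite_allFaces hP).subset fun G hG => hG.mem_allFaces
  have hev : ∀ᶠ t : ℝ in 𝓝[>] 0, ∀ G ∈ {G | IsFacet P G}, ∀ u, IsFacetNormal P G u →
      ∀ q ∈ G, ⟪u, x + t • z - q⟫_ℝ ≤ 0 := by
    refine (eventually_all_finite hfin).2 fun G hG => ?_
    -- A facet without a normal would impose no condition, so existence of normals is not needed.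
    by_cases hex : ∃ u, IsFacetNormal P G u
    · obtain ⟨u, hu⟩ := hex
      have hsup := hu.support_eq hG
      have key : ∀ᶠ t : ℝ in 𝓝[>] 0, ∀ q ∈ G, ⟪u, x + t • z - q⟫_ℝ ≤ 0 := by
        by_cases hxG : x ∈ G
        · filter_upwards [self_mem_nhdsWithin] with t ht q hq
          have h1 := hu.2.2.2 q hq x hx
          have h2 := h G u hG hu hxG
          rw [show x + t • z - q = (x - q) + t • z by abel, inner_add_right, inner_smul_right]
          have : t * ⟪u, z⟫_ℝ ≤ 0 := mul_nonpos_of_nonneg_of_nonpos (le_of_lt ht) h2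
          linarith
        · obtain ⟨q₀, hq₀⟩ := hG.mem_allFaces.1
          have hneg : ⟪u, x - q₀⟫_ℝ < 0 := by
            refine lt_of_le_of_ne (hu.2.2.2 q₀ hq₀ x hx) fun h0 => hxG ?_
            rw [← hsup]
            refine ⟨hx, fun y hy => ?_⟩
            have := hu.2.2.2 q₀ hq₀ y hy
            rw [show y - x = (y - q₀) - (x - q₀) by abel, inner_sub_right, h0]
            linarith
          have hlim : Tendsto (fun t : ℝ => ⟪u, x + t • z - q₀⟫_ℝ) (𝓝[>] 0) (𝓝 ⟪u, x - q₀⟫_ℝ) := by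
            refine Tendsto.mono_left ?_ nhdsWithin_le_nhds
            exact Continuous.tendsto' (by fun_prop) _ _ (by simp)
          filter_upwards [hlim.eventually_lt_const hneg] with t ht q hq
          have h1 : ⟪u, q - q₀⟫_ℝ = 0 :=
            support_inner_eq (P := P) (v := u) (hsup ▸ hq₀) (hsup ▸ hq)
          rw [show x + t • z - q = (x + t • z - q₀) - (q - q₀) by abel, inner_sub_right, h1]
          linarith
      filter_upwards [key] with t ht w hw
      rw [hu.unique hG hw]
      exact ht
    · exact Eventually.of_forall fun t u hu => (hex ⟨u, hu⟩).elim
  obtain ⟨t, ht, ht0⟩ := (hev.and self_mem_nhdsWithin).exists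
  refine ⟨t, ht0, ?_⟩
  by_contra hnot
  obtain ⟨G, u, hG, hu, q, hq, hlt⟩ := exists_facet_separating hP (y := x + t • z) (by
    rw [add_comm]
    exact AffineSubspace.vadd_mem_of_mem_direction
      (by rw [direction_affineSpan]; exact Submodule.smul_mem _ _ hz)
      (subset_affineSpan ℝ P hx)) hnot
  exact hlt.not_ge (ht G hG u hu q hq)

theorem normalCone_eq_sup (F P : Set (E n)) : normalCone F P =
    ((relNormalCone F P ⊔ PointedCone.ofSubmodule (vectorSpan ℝ P)ᗮ : PointedCone ℝ (E n)) :
      Set (E n)) := by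
  rw [Submodule.coe_sup]
  rfl

theorem normalCone_subset_polarCone {P F : Set (E n)} (hF : F ∈ allFaces P) :
    normalCone F P ⊆ polarCone F P := by
  rintro _ ⟨a, ha, w, hw, rfl⟩ x hx y hy
  have hw' : ⟪w, y - x⟫_ℝ = 0 := (Submodule.mem_orthogonal' _ _).1 hw _
    (vsub_mem_vectorSpan ℝ hy (hF.2.subset hx))
  change ⟪a + w, y - x⟫_ℝ ≤ 0
  rw [inner_add_left, hw', add_zero]
  induction ha using Submodule.span_induction with
  | mem u hu =>
    obtain ⟨G, -, hFG, hu⟩ := hu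
    exact hu.2.2.2 x (hFG hx) y hy
  | zero => simp
  | add a b _ _ ha hb =>
    rw [inner_add_left]
    linarith
  | smul c a _ ha =>
    change ⟪(c : ℝ) • a, y - x⟫_ℝ ≤ 0
    rw [real_inner_smul_left]
    exact mul_nonpos_of_nonneg_of_nonpos c.2 ha

/-- Farkas' lemma for the normal cone of a polytope. -/
theorem polarCone_subset_closure {P F : Set (E n)} (hP : IsPolytope P) (hF : F ∈ allFaces P) :
    polarCone F P ⊆ closure (normalCone F P) := by
  intro v hv
  rw [normalCone_eq_sup]
  set C : PointedCone ℝ (E n) := relNormalCone F P ⊔ PointedCone.ofSubmodule (vectorSpan ℝ P)ᗮ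
  by_contra hnot
  obtain ⟨y, hy, hvy⟩ := ProperCone.hyperplane_separation' (Submodule.closure C) (x₀ := v) hnot
  have hyC : ∀ c ∈ C, 0 ≤ ⟪c, y⟫_ℝ := fun c hc => hy c (subset_closure hc)
  -- `C` contains the subspace `[P]ᗮ` with both signs, so `y` is orthogonal to it.
  have hyP : y ∈ vectorSpan ℝ P := by
    rw [← Submodule.orthogonal_orthogonal (vectorSpan ℝ P), Submodule.mem_orthogonal]
    intro w hw
    have h1 := hyC w (Submodule.mem_sup_right hw)
    have h2 := hyC (-w) (Submodule.mem_sup_right (Submodule.neg_mem _ hw))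
    rw [inner_neg_left] at h2
    linarith
  obtain ⟨x, hx⟩ := openFace_nonempty hP hF
  -- Facets through a point of the open face contain `F`, so `-y` is on the inner side of each and
  -- points into `P`; this contradicts `⟪v, y⟫ < 0`.
  obtain ⟨t, ht, hmem⟩ := exists_add_smul_mem hP (hF.2.subset hx.1) (Submodule.neg_mem _ hyP) (by
    intro G u hG hu hxG
    have := hyC u (Submodule.mem_sup_left
      (PointedCone.subset_hull ⟨G, hG, hx.2 G hG.mem_allFaces.2 hxG, hu⟩))
    rw [inner_neg_right]
    linarith)
  have := hv x hx.1 _ hmem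
  rw [add_sub_cancel_left, inner_smul_right, inner_neg_right] at this
  nlinarith

theorem vol_polarCone_inter {P F : Set (E n)} (hP : IsPolytope P) (hF : F ∈ allFaces P) :
    vol (n - dim F) (polarCone F P ∩ Metric.closedBall 0 1) =
      vol (n - dim F) (normalCone F P ∩ Metric.closedBall 0 1) := by
  have hconv : Convex ℝ (normalCone F P) := by
    rw [normalCone_eq_sup]
    exact PointedCone.convex _
  have hsub := normalCone_subset_polarCone hF
  have hnull := hausdorff_diff_eq_zero (vectorSpan ℝ F)ᗮ hconv (polarCone_subset_orthogonal hF) (by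
    rw [inter_eq_left.2 (hsub.trans (polarCone_subset_orthogonal hF))]
    exact polarCone_subset_closure hP hF)
  rw [finrank_orthogonal_eq] at hnull
  rw [vol, vol, measureReal_def, measureReal_def]
  congr 1
  refine le_antisymm ?_ (measure_mono (inter_subset_inter_left _ hsub))
  calc _ ≤ (μHE[n - dim F] : Measure (E n)) ((normalCone F P ∩ Metric.closedBall 0 1) ∪
        (polarCone F P \ normalCone F P)) := measure_mono fun v hv => by
          by_cases h : v ∈ normalCone F P
          exacts [Or.inl ⟨h, hv.2⟩, Or.inr ⟨hv.1, h⟩]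
    _ ≤ _ := (measure_union_le _ _).trans (by rw [hnull, add_zero])

/-! ### Tube formulas: uniqueness and polytopes -/

theorem ballVolume_pos (k : ℕ) : 0 < ballVolume k :=
  ENNReal.toReal_pos (Metric.measure_closedBall_pos volume _ zero_lt_one).ne'
    measure_closedBall_lt_top.ne

/-- The numbers `c` are the coefficients of the volume of the tubes around `K`. -/
def HasTubeFormula (K : Set (E n)) (c : ℕ → ℝ) : Prop :=
  ∀ ε : ℝ, 0 ≤ ε → (volume : Measure (E n)).real (tube K ε) =
    ∑ i ∈ Finset.range (n + 1), ballVolume i * c (n - i) * ε ^ i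

theorem eq_of_sum_pow_eq {m : ℕ} {a b : ℕ → ℝ}
    (h : ∀ ε : ℝ, 0 ≤ ε →
      ∑ i ∈ Finset.range m, a i * ε ^ i = ∑ i ∈ Finset.range m, b i * ε ^ i) {i : ℕ} (hi : i < m) :
    a i = b i := by
  have key : ∀ c : ℕ → ℝ, ∀ x : ℝ, (∑ i ∈ Finset.range m,
      Polynomial.C (c i) * Polynomial.X ^ i).eval x = ∑ i ∈ Finset.range m, c i * x ^ i :=
    fun c x => by simp [Polynomial.eval_finsetSum]
  have hp := Polynomial.eq_of_infinite_eval_eq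
    (∑ i ∈ Finset.range m, Polynomial.C (a i) * Polynomial.X ^ i)
    (∑ i ∈ Finset.range m, Polynomial.C (b i) * Polynomial.X ^ i)
    ((Set.Ici_infinite (0 : ℝ)).mono fun x hx => by
      change Polynomial.eval x _ = Polynomial.eval x _
      rw [key, key]
      exact h x hx)
  simpa [Polynomial.finsetSum_coeff, Polynomial.coeff_C_mul, Polynomial.coeff_X_pow, hi]
    using congrArg (fun p => Polynomial.coeff p i) hp

theorem HasTubeFormula.unique {K : Set (E n)} {b c : ℕ → ℝ} (hb : HasTubeFormula K b)
    (hc : HasTubeFormula K c) {i : ℕ} (hi : i ≤ n) : b i = c i := by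
  have h := eq_of_sum_pow_eq (m := n + 1) (a := fun i => ballVolume i * b (n - i))
    (b := fun i => ballVolume i * c (n - i)) (fun ε hε => (hb ε hε).symm.trans (hc ε hε))
    (i := n - i) (by omega)
  simp only [Nat.sub_sub_self hi] at h
  exact mul_left_cancel₀ (ballVolume_pos _).ne' h

/-- A tube formula for positive radii extends to radius zero. -/
theorem HasTubeFormula.of_pos {K : Set (E n)} (hK : IsCompact K) {c : ℕ → ℝ}
    (h : ∀ ε : ℝ, 0 < ε → (volume : Measure (E n)).real (tube K ε) =
      ∑ i ∈ Finset.range (n + 1), ballVolume i * c (n - i) * ε ^ i) : HasTubeFormula K c := by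
  intro ε hε
  rcases hε.lt_or_eq with hpos | rfl
  · exact h ε hpos
  -- The closed thickenings decrease to `K`, so their volumes are right-continuous at zero.
  have h1 : Tendsto (fun r => (volume : Measure (E n)).real (tube K r)) (𝓝[>] 0)
      (𝓝 ((volume : Measure (E n)).real (tube K 0))) := by
    have h0 := (ENNReal.tendsto_toReal hK.measure_lt_top.ne).comp
      ((tendsto_measure_cthickening_of_isCompact (μ := (volume : Measure (E n))) hK).mono_left
        (nhdsWithin_le_nhds (s := Ioi 0)))
    rw [tube_eq_cthickening hK le_rfl, Metric.cthickening_zero, hK.isClosed.closure_eq]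
    refine h0.congr' ?_
    filter_upwards [self_mem_nhdsWithin] with r hr
    rw [tube_eq_cthickening hK (le_of_lt hr)]
    rfl
  have h2 : Tendsto (fun r : ℝ => ∑ i ∈ Finset.range (n + 1), ballVolume i * c (n - i) * r ^ i)
      (𝓝[>] 0) (𝓝 (∑ i ∈ Finset.range (n + 1), ballVolume i * c (n - i) * 0 ^ i)) :=
    (Continuous.tendsto (by fun_prop) 0).mono_left nhdsWithin_le_nhds
  refine tendsto_nhds_unique h1 (h2.congr' ?_)
  filter_upwards [self_mem_nhdsWithin] with r hr
  exact (h r hr).symm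

theorem faces_eq_filter {P : Set (E n)} (hP : IsPolytope P) (i : ℕ) :
    faces i P = ((finite_allFaces hP).toFinset.filter fun F => dim F = i : Finset (Set (E n))) := by
  ext F
  simp [faces, allFaces, and_assoc]

/-- The tube formula for polytopes. -/
theorem hasTubeFormula_polytope {P : Set (E n)} (hP : IsPolytope P) :
    HasTubeFormula P fun i => ∑ᶠ F ∈ faces i P, vol i F * exteriorAngle F P := by
  refine HasTubeFormula.of_pos hP.isCompact fun ε hε => ?_
  -- The exponent of `ε` is the codimension; the flip indexes the sum by face dimension.
  rw [volume_tube_polytope hP hε, ← Finset.sum_flip, ← Finset.sum_fiberwise_of_maps_to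
    (g := dim) (t := Finset.range (n + 1)) fun F _ => Finset.mem_range_succ_iff.2 (dim_le F)]
  refine Finset.sum_congr rfl fun i hi => ?_
  rw [Nat.sub_sub_self (Finset.mem_range_succ_iff.1 hi), faces_eq_filter hP, finsum_mem_coe_finset,
    Finset.mul_sum, Finset.sum_mul]
  refine Finset.sum_congr rfl fun F hF => ?_
  obtain ⟨hF, rfl⟩ := Finset.mem_filter.1 hF
  rw [vol_polarCone_inter hP (by simpa using hF), exteriorAngle]
  have := (ballVolume_pos (n - dim F)).ne'
  field_simp

/-! ### Passage to compact convex sets -/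

/-- A pointwise limit of polynomials of bounded degree is a polynomial. -/
theorem exists_sum_pow_of_tendsto {m : ℕ} {a : ℕ → ℕ → ℝ} {f : ℝ → ℝ}
    (h : ∀ ε : ℝ, 0 < ε →
      Tendsto (fun k => ∑ i ∈ Finset.range m, a k i * ε ^ i) atTop (𝓝 (f ε))) :
    ∃ b : ℕ → ℝ, ∀ ε : ℝ, 0 < ε → f ε = ∑ i ∈ Finset.range m, b i * ε ^ i := by
  -- The nodes are shifted by one because convergence is known only at positive arguments.
  let v : ℕ → ℝ := fun j => j + 1
  have hv : Set.InjOn v (Finset.range m) := fun i _ j _ hij => by simpa [v] using hij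
  let p : ℕ → Polynomial ℝ := fun k =>
    ∑ i ∈ Finset.range m, Polynomial.C (a k i) * Polynomial.X ^ i
  have hp : ∀ k x, (p k).eval x = ∑ i ∈ Finset.range m, a k i * x ^ i := fun k x => by
    simp [p, Polynomial.eval_finsetSum]
  have hdeg : ∀ k, (p k).degree < (Finset.range m).card := fun k => by
    rw [Finset.card_range, Polynomial.degree_lt_iff_coeff_zero]
    intro j hj
    simp [p, Polynomial.finsetSum_coeff, Polynomial.coeff_X_pow, hj]
  let q := Lagrange.interpolate (Finset.range m) v fun j => f (v j)
  have hqdeg : q.degree < m := by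
    have := Lagrange.degree_interpolate_lt (fun j => f (v j)) hv
    rwa [Finset.card_range] at this
  have heval : ∀ (r : ℕ → ℝ) (x : ℝ), (Lagrange.interpolate (Finset.range m) v r).eval x =
      ∑ j ∈ Finset.range m, r j * (Lagrange.basis (Finset.range m) v j).eval x := fun r x => by
    simp [Lagrange.interpolate_apply, Polynomial.eval_finsetSum]
  refine ⟨q.coeff, fun ε hε => ?_⟩
  have hsum : ∑ i ∈ Finset.range m, q.coeff i * ε ^ i = q.eval ε := by
    rcases Nat.eq_zero_or_pos m with rfl | hm
    · simp [q]
    · refine (Polynomial.eval_eq_sum_range' ?_ ε).symm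
      by_cases hq : q = 0
      · simpa [hq] using hm
      · exact (Polynomial.natDegree_lt_iff_degree_lt hq).2 hqdeg
  rw [hsum]
  refine tendsto_nhds_unique (h ε hε) ?_
  -- The value at `ε` is a fixed linear combination of the values at the nodes.
  have hlim : Tendsto (fun k => ∑ j ∈ Finset.range m,
      (p k).eval (v j) * (Lagrange.basis (Finset.range m) v j).eval ε) atTop (𝓝 (q.eval ε)) := by
    rw [heval]
    refine tendsto_finsetSum _ fun j _ => Tendsto.mul_const _ ?_
    simp only [hp]
    exact h (v j) (by positivity)
  refine hlim.congr fun k => ?_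
  rw [← heval, ← Lagrange.eq_interpolate_of_eval_eq (fun j => (p k).eval (v j)) hv (hdeg k)
    fun j _ => rfl, hp]

theorem tube_mono {A B : Set (E n)} (h : A ⊆ B) (ε : ℝ) : tube A ε ⊆ tube B ε :=
  biUnion_subset_biUnion_left h

/-- A compact convex set is exhausted by polytopes, with convergence of the volumes of tubes. -/
theorem exists_polytopes_tendsto {K : Set (E n)} (hK : IsCompact K) (hc : Convex ℝ K)
    (hne : K.Nonempty) : ∃ P : ℕ → Set (E n), (∀ k, IsPolytope (P k)) ∧ ∀ ε : ℝ, 0 < ε →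
      Tendsto (fun k => (volume : Measure (E n)).real (tube (P k) ε)) atTop
        (𝓝 ((volume : Measure (E n)).real (tube K ε))) := by
  have : Nonempty K := hne.to_subtype
  let d : ℕ → E n := fun j => (TopologicalSpace.denseSeq K j : E n)
  have hdK : ∀ k, convexHull ℝ (d '' Iic k) ⊆ K := fun k =>
    convexHull_min (by rintro _ ⟨j, -, rfl⟩; exact Subtype.prop _) hc
  refine ⟨fun k => convexHull ℝ (d '' Iic k), fun k => ⟨_, (finite_Iic k).image d, rfl⟩,
    fun ε hε => ?_⟩
  have hmono : Monotone fun k => tube (convexHull ℝ (d '' Iic k)) ε := fun k l hkl =>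
    tube_mono (convexHull_mono (image_mono (Iic_subset_Iic.2 hkl))) ε
  have hsub : ⋃ k, tube (convexHull ℝ (d '' Iic k)) ε ⊆ tube K ε :=
    iUnion_subset fun k => tube_mono (hdK k) ε
  have hsup : Metric.thickening ε K ⊆ ⋃ k, tube (convexHull ℝ (d '' Iic k)) ε := by
    intro x hx
    obtain ⟨y, hy, hxy⟩ := Metric.mem_thickening_iff.1 hx
    obtain ⟨j, hj⟩ := (TopologicalSpace.denseRange_denseSeq K).exists_dist_lt (⟨y, hy⟩ : K)
      (sub_pos.2 hxy)
    refine mem_iUnion.2 ⟨j, mem_biUnion (subset_convexHull ℝ _ (mem_image_of_mem d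
      (mem_Iic.2 le_rfl))) ?_⟩
    have h1 : dist y (d j) < ε - dist x y := hj
    have h2 := dist_triangle x y (d j)
    rw [Metric.mem_closedBall]
    linarith
  have hvol : (volume : Measure (E n)) (⋃ k, tube (convexHull ℝ (d '' Iic k)) ε) =
      volume (tube K ε) := by
    -- The union contains the open thickening, which differs from the closed one by the null
    -- frontier of a convex set.
    refine le_antisymm (measure_mono hsub) ?_
    rw [tube_eq_cthickening hK hε.le, ← closure_thickening hε, closure_eq_self_union_frontier]
    refine (measure_union_le _ _).trans ?_
    rw [(hc.thickening ε).addHaar_frontier volume, add_zero]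
    exact measure_mono hsup
  have hlim := tendsto_measure_iUnion_atTop (μ := (volume : Measure (E n))) hmono
  rw [hvol] at hlim
  exact (ENNReal.tendsto_toReal (volume_tube_lt_top hK hε.le).ne).comp hlim

/-- **Steiner's formula** for compact convex sets. -/
theorem exists_hasTubeFormula {K : Set (E n)} (hK : IsCompact K) (hc : Convex ℝ K) :
    ∃ c, HasTubeFormula K c := by
  rcases K.eq_empty_or_nonempty with rfl | hne
  · exact ⟨0, fun ε _ => by simp [tube]⟩
  obtain ⟨P, hP, hlim⟩ := exists_polytopes_tendsto hK hc hne
  obtain ⟨b, hb⟩ := exists_sum_pow_of_tendsto (m := n + 1)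
    (a := fun k i => ballVolume i * ∑ᶠ F ∈ faces (n - i) (P k), vol (n - i) F *
      exteriorAngle F (P k)) (f := fun ε => (volume : Measure (E n)).real (tube K ε))
    fun ε hε => (hlim ε hε).congr fun k => hasTubeFormula_polytope (hP k) ε hε.le
  refine ⟨fun i => b (n - i) / ballVolume (n - i), HasTubeFormula.of_pos hK fun ε hε => ?_⟩
  rw [hb ε hε]
  refine Finset.sum_congr rfl fun i hi => ?_
  rw [Nat.sub_sub_self (Finset.mem_range_succ_iff.1 hi), mul_div_cancel₀ _ (ballVolume_pos i).ne']

/-! ### Isometries and the coefficients -/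

theorem HasTubeFormula.image {K : Set (E n)} {c : ℕ → ℝ} (h : HasTubeFormula K c)
    (g : E n ≃ᵢ E n) : HasTubeFormula (g '' K) c := by
  intro ε hε
  have htube : tube (g '' K) ε = g '' tube K ε := by
    simp [tube, image_iUnion, IsometryEquiv.image_closedBall]
  rw [← h ε hε, htube, ← EuclideanSpace.euclideanHausdorffMeasure_eq_volume, measureReal_def,
    g.isometry.euclideanHausdorffMeasure_image, measureReal_def]

/-- By Mazur–Ulam a surjective isometry is affine. -/
theorem convex_image_isometryEquiv {K : Set (E n)} (hc : Convex ℝ K) (g : E n ≃ᵢ E n) :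
    Convex ℝ (g '' K) := by
  have := hc.affine_image g.toRealAffineIsometryEquiv.toAffineEquiv.toAffineMap
  simpa using this

open Classical in
/-- The coefficients of the tube formula of `K`. -/
def tubeCoeff (i : ℕ) (K : Set (E n)) : ℝ :=
  if h : ∃ c, HasTubeFormula K c then h.choose i else 0

theorem hasTubeFormula_tubeCoeff {K : Set (E n)} (hK : IsCompact K) (hc : Convex ℝ K) :
    HasTubeFormula K fun i => tubeCoeff i K := by
  have h := exists_hasTubeFormula hK hc
  have heq : (fun i => tubeCoeff i K) = h.choose := funext fun i => dif_pos h
  rw [heq]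
  exact h.choose_spec

end SteinerTube

end

theorem mainTheorem1 (n : ℕ) :
    ∃ Λ : ℕ → Set (SteinerTube.E n) → ℝ,
      -- the tube formula for compact convex sets
      (∀ K : Set (SteinerTube.E n), IsCompact K → Convex ℝ K → ∀ ε : ℝ, 0 ≤ ε →
        (volume : Measure (SteinerTube.E n)).real (SteinerTube.tube K ε) =
          ∑ i ∈ Finset.range (n + 1), SteinerTube.ballVolume i * Λ (n - i) K * ε ^ i) ∧
      -- the coefficients of a polytope in terms of its faces and exterior angles
      (∀ P : Set (SteinerTube.E n), SteinerTube.IsPolytope P → ∀ i ≤ n,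
        Λ i P = ∑ᶠ F ∈ SteinerTube.faces i P,
          SteinerTube.vol i F * SteinerTube.exteriorAngle F P) ∧
      -- the coefficients are determined by the tube formula
      (∀ K : Set (SteinerTube.E n), IsCompact K → Convex ℝ K → ∀ c : ℕ → ℝ,
        (∀ ε : ℝ, 0 ≤ ε → (volume : Measure (SteinerTube.E n)).real (SteinerTube.tube K ε) =
          ∑ i ∈ Finset.range (n + 1), SteinerTube.ballVolume i * c (n - i) * ε ^ i) →
        ∀ i ≤ n, c i = Λ i K) ∧
      -- the coefficients are invariant under isometries
      (∀ K : Set (SteinerTube.E n), IsCompact K → Convex ℝ K →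
        ∀ g : SteinerTube.E n ≃ᵢ SteinerTube.E n, ∀ i ≤ n, Λ i (g '' K) = Λ i K) := by
  refine ⟨fun i K => SteinerTube.tubeCoeff i K, fun K hK hc =>
      SteinerTube.hasTubeFormula_tubeCoeff hK hc, fun P hP i hi =>
      (SteinerTube.hasTubeFormula_tubeCoeff hP.isCompact hP.convex).unique
        (SteinerTube.hasTubeFormula_polytope hP) hi,
    fun K hK hc c h i hi => SteinerTube.HasTubeFormula.unique h
      (SteinerTube.hasTubeFormula_tubeCoeff hK hc) hi,
    fun K hK hc g i hi => ?_⟩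
  exact (SteinerTube.hasTubeFormula_tubeCoeff (hK.image g.continuous)
    (SteinerTube.convex_image_isometryEquiv hc g)).unique
      ((SteinerTube.hasTubeFormula_tubeCoeff hK hc).image g) hi
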